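/- Let $k$ be a field. Regard a representation of a Lie algebra over $k$ as a two-sorted algebra $A=A^{(1)}\uplus A^{(2)}$: the first sort $A^{(1)}$ carries the operations of a Lie algebra over $k$ ($0$, $-$, $+$, one unary operation for each scalar $\lambda\in k$, and the bracket, which satisfies $[x,x]=0$ and the Jacobi identity), the second sort $A^{(2)}$ carries the operations of a vector space over $k$, and there is a bilinear action $\circ$ of type $(1,2;2)$ with $[x,y]\circ v=x\circ(y\circ v)-y\circ(x\circ v)$. A variety is the class of all algebras of a given signature that satisfy a given set of identities (between terms in finitely many variables). A variety $\Theta$ is $i$-nondegenerate if the identity $x_1^{(i)}=x_2^{(i)}$ between two distinct variables of sort $i$ does not hold in $\Theta$, and nondegenerate if this is so for every sort $i$. It is an $i$-IBN-variety if, whenever two free algebras $F_\Theta(Y)\cong F_\Theta(Z)$ of $\Theta$ with finite sets $Y,Z$ of free generators are isomorphic, $|Y^{(i)}|=|Z^{(i)}|$ (where $Y^{(i)}$ is the set of elements of $Y$ of sort $i$), and an IBN-variety if this is so for every sort $i$. For a variety $\Xi$ of representations of Lie algebras and $i\in\{1,2\}$ let $\Xi^{(i)}$ be the variety of one-sorted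 algebras defined by those identities of $\Xi$ both of whose sides are terms built from variables of sort $i$ and operations of the sort $i$ alone. Let $\Theta$ be a nondegenerate variety of representations of Lie algebras over $k$, and let $\Delta$ be the subvariety of $\Theta$ defined by the identity $x^{(1)}\circ x^{(2)}=0^{(2)}$. Then: 1. $\Theta^{(1)}$ is a nondegenerate variety of Lie algebras over $k$, and it is an IBN-variety; 2. $\Delta^{(2)}$ is the variety of all vector spaces over $k$; it is an IBN-variety, and $\Delta$ is a $2$-nondegenerate $2$-IBN-variety; 3. $\Theta$ is an IBN-variety. -/

import Mathlib

universe u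

namespace ManySorted

/-- A many-sorted signature with set of sorts `Γ`: an operation `o` has type
`(dom o 0, …, dom o (arity o - 1); cod o)`. Constants are the operations of arity `0`. -/
structure Signature (Γ : Type) where
  Op : Type u
  arity : Op → ℕ
  dom : (o : Op) → Fin (arity o) → Γ
  cod : Op → Γ

/-- A many-sorted algebra; `carrier i` is the (possibly empty) set of elements of sort `i`. -/
structure Alg {Γ : Type} (S : Signature.{u} Γ) where
  carrier : Γ → Type u
  op : (o : S.Op) → ((j : Fin (S.arity o)) → carrier (S.dom o j)) → carrier (S.cod o)

/-- Homomorphisms: sort-preserving maps which commute with all operations. -/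
structure Hom {Γ : Type} {S : Signature.{u} Γ} (A B : Alg S) where
  toFun : (i : Γ) → A.carrier i → B.carrier i
  map_op : ∀ (o : S.Op) (a : (j : Fin (S.arity o)) → A.carrier (S.dom o j)),
    toFun (S.cod o) (A.op o a) = B.op o (fun j => toFun (S.dom o j) (a j))

/-- Two algebras are isomorphic if there is a bijective homomorphism between them. -/
def Isomorphic {Γ : Type} {S : Signature.{u} Γ} (A B : Alg S) : Prop :=
  ∃ φ : Hom A B, ∀ i, Function.Bijective (φ.toFun i)

/-- `Term S X i` is the set of terms of sort `i` over the variables `X` (`X i` being the set of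
variables of sort `i`). -/
inductive Term {Γ : Type} (S : Signature.{u} Γ) (X : Γ → Type) : Γ → Type u
  | var {i : Γ} (x : X i) : Term S X i
  | op (o : S.Op) (args : (j : Fin (S.arity o)) → Term S X (S.dom o j)) : Term S X (S.cod o)

/-- The value of a term in `A`, i.e. its image under the unique homomorphism from the algebra of
terms to `A` which extends the assignment `v` of the variables. -/
def Term.eval {Γ : Type} {S : Signature.{u} Γ} {X : Γ → Type} (A : Alg S)
    (v : (i : Γ) → X i → A.carrier i) : {i : Γ} → Term S X i → A.carrier i
  | _, .var x => v _ x
  | _, .op o args => A.op o (fun j => (args j).eval A v)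

/-- An identity `lhs = rhs` between two terms of the same sort in finitely many variables,
`nvars i` of them being of sort `i`. -/
structure Identity {Γ : Type} [Finite Γ] (S : Signature.{u} Γ) where
  nvars : Γ → ℕ
  sort : Γ
  lhs : Term S (fun i => Fin (nvars i)) sort
  rhs : Term S (fun i => Fin (nvars i)) sort

section Varieties

variable {Γ : Type} [Finite Γ] {S : Signature.{u} Γ}

/-- `A ⊨ e`; this holds vacuously if `A` has no elements of the sort of some variable of `e`. -/
def Satisfies (A : Alg S) (e : Identity S) : Prop :=
  ∀ v : (i : Γ) → Fin (e.nvars i) → A.carrier i, e.lhs.eval A v = e.rhs.eval A v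

/-- The class of all algebras satisfying the set `I` of identities. -/
def Var (I : Set (Identity S)) : Set (Alg S) := {A | ∀ e ∈ I, Satisfies A e}

def IsVariety (Θ : Set (Alg S)) : Prop := ∃ I : Set (Identity S), Θ = Var I

/-- All identities which hold in all algebras of the class `Θ`. -/
def identitiesOf (Θ : Set (Alg S)) : Set (Identity S) := {e | ∀ A ∈ Θ, Satisfies A e}

/-- The identity `x₁ = x₂` between two distinct variables of sort `i`. -/
def collapse [DecidableEq Γ] (S : Signature.{u} Γ) (i : Γ) : Identity S where
  nvars := fun j => if j = i then 2 else 0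
  sort := i
  lhs := .var ⟨0, by simp⟩
  rhs := .var ⟨1, by simp⟩

def NondegenerateAt [DecidableEq Γ] (i : Γ) (Θ : Set (Alg S)) : Prop :=
  collapse S i ∉ identitiesOf Θ

def Nondegenerate [DecidableEq Γ] (Θ : Set (Alg S)) : Prop := ∀ i, NondegenerateAt i Θ

/-- `F` is a free algebra of `Θ` with the set `Y` of free generators (`Y i` being the set of free
generators of sort `i`). If `H` is empty in the sort of some generator, then there is no `f`. -/
def IsFree (Θ : Set (Alg S)) (F : Alg S) (Y : (i : Γ) → Set (F.carrier i)) : Prop :=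
  F ∈ Θ ∧ ∀ H ∈ Θ, ∀ f : (i : Γ) → Y i → H.carrier i,
    ∃! φ : Hom F H, ∀ (i : Γ) (y : Y i), φ.toFun i y = f i y

/-- The invariant basis number property for the sort `i`: isomorphic finitely generated free
algebras have equally many free generators of sort `i`. -/
def IsIBNAt (i : Γ) (Θ : Set (Alg S)) : Prop :=
  ∀ (F G : Alg S) (Y : (j : Γ) → Set (F.carrier j)) (Z : (j : Γ) → Set (G.carrier j)),
    (∀ j, (Y j).Finite) → (∀ j, (Z j).Finite) → IsFree Θ F Y → IsFree Θ G Z →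
      Isomorphic F G → (Y i).encard = (Z i).encard

def IsIBN (Θ : Set (Alg S)) : Prop := ∀ i, IsIBNAt i Θ

end Varieties

/-! Two-sorted algebras in which the elements of the first sort act on those of the second. -/

inductive ActSort : Type
  | one | two
  deriving DecidableEq

instance : Finite ActSort :=
  Finite.of_surjective (fun b : Bool => cond b ActSort.one ActSort.two)
    (by rintro (_ | _); exacts [⟨true, rfl⟩, ⟨false, rfl⟩])

inductive ActOp (O₁ O₂ : Type u) : Type u
  | first (o : O₁)
  | second (o : O₂)
  | act

/-- The two-sorted signature consisting of the operations of `S₁` on the first sort, the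
operations of `S₂` on the second sort, and a binary operation of type `(1, 2; 2)`. -/
def actSig (S₁ S₂ : Signature.{u} Unit) : Signature.{u} ActSort where
  Op := ActOp S₁.Op S₂.Op
  arity
    | .first o => S₁.arity o
    | .second o => S₂.arity o
    | .act => 2
  dom
    | .first _ => fun _ => .one
    | .second _ => fun _ => .two
    | .act => fun j : Fin 2 => match j with
      | 0 => .one
      | 1 => .two
  cod
    | .first _ => .one
    | .second _ => .two
    | .act => .two

section Action

variable {S₁ S₂ : Signature.{u} Unit}

/-- The term `s ∘ t`. -/
def Term.act {X : ActSort → Type} (s : Term (actSig S₁ S₂) X .one)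
    (t : Term (actSig S₁ S₂) X .two) : Term (actSig S₁ S₂) X .two :=
  .op (S := actSig S₁ S₂) .act (fun j : Fin 2 => match j with
    | 0 => s
    | 1 => t)

/-- A term of the first one-sorted signature as a two-sorted term of the first sort. -/
def Term.toOne {X : ActSort → Type} {i : Unit} :
    Term S₁ (fun _ => X .one) i → Term (actSig S₁ S₂) X .one
  | .var x => .var (i := ActSort.one) x
  | .op o args => .op (S := actSig S₁ S₂) (.first o) (fun j => (args j).toOne)

/-- A term of the second one-sorted signature as a two-sorted term of the second sort. -/
def Term.toTwo {X : ActSort → Type} {i : Unit} :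
    Term S₂ (fun _ => X .two) i → Term (actSig S₁ S₂) X .two
  | .var x => .var (i := ActSort.two) x
  | .op o args => .op (S := actSig S₁ S₂) (.second o) (fun j => (args j).toTwo)

/-- `m` variables of the first sort and `n` variables of the second sort. -/
def vars (m n : ℕ) : ActSort → ℕ
  | .one => m
  | .two => n

/-- A one-sorted identity as a two-sorted identity of the first sort, considered in `m` further
variables of the second sort. -/
def Identity.toOne (S₂ : Signature.{u} Unit) (e : Identity S₁) (m : ℕ) :
    Identity (actSig S₁ S₂) where
  nvars := vars (e.nvars ()) m
  sort := .one
  lhs := Term.toOne (X := fun i => Fin (vars (e.nvars ()) m i)) e.lhs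
  rhs := Term.toOne (X := fun i => Fin (vars (e.nvars ()) m i)) e.rhs

/-- A one-sorted identity as a two-sorted identity of the second sort, considered in `m` further
variables of the first sort. -/
def Identity.toTwo (S₁ : Signature.{u} Unit) (e : Identity S₂) (m : ℕ) :
    Identity (actSig S₁ S₂) where
  nvars := vars m (e.nvars ())
  sort := .two
  lhs := Term.toTwo (X := fun i => Fin (vars m (e.nvars ()) i)) e.lhs
  rhs := Term.toTwo (X := fun i => Fin (vars m (e.nvars ()) i)) e.rhs

/-- `Θ⁽¹⁾`: the variety of one-sorted algebras defined by those identities of `Θ` which are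
identities between terms of the first signature. -/
def partOne (Θ : Set (Alg (actSig S₁ S₂))) : Set (Alg S₁) :=
  Var {e | ∃ m, e.toOne S₂ m ∈ identitiesOf Θ}

/-- `Θ⁽²⁾`: the variety of one-sorted algebras defined by those identities of `Θ` which are
identities between terms of the second signature. -/
def partTwo (Θ : Set (Alg (actSig S₁ S₂))) : Set (Alg S₂) :=
  Var {e | ∃ m, e.toTwo S₁ m ∈ identitiesOf Θ}

end Action

/-! Vector spaces and Lie algebras over `k` as one-sorted algebras, each scalar giving a unary
operation. -/

inductive VecOp (k : Type u) : Type u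
  | zero | neg | add
  | smul (c : k)

inductive LieOp (k : Type u) : Type u
  | lin (o : VecOp k)
  | bracket

def VecOp.arity {k : Type u} : VecOp k → ℕ
  | .zero => 0
  | .neg => 1
  | .add => 2
  | .smul _ => 1

def vecSig (k : Type u) : Signature.{u} Unit where
  Op := VecOp k
  arity := VecOp.arity
  dom := fun _ _ => ()
  cod := fun _ => ()

def lieSig (k : Type u) : Signature.{u} Unit where
  Op := LieOp k
  arity
    | .lin o => o.arity
    | .bracket => 2
  dom := fun _ _ => ()
  cod := fun _ => ()

section Linear

variable {k : Type u} {X : Unit → Type}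

def vZero : Term (vecSig k) X () := .op (S := vecSig k) .zero (fun j : Fin 0 => ![] j)
def vNeg (s : Term (vecSig k) X ()) : Term (vecSig k) X () := .op (S := vecSig k) .neg ![s]
def vAdd (s t : Term (vecSig k) X ()) : Term (vecSig k) X () := .op (S := vecSig k) .add ![s, t]
def vSmul (c : k) (s : Term (vecSig k) X ()) : Term (vecSig k) X () :=
  .op (S := vecSig k) (.smul c) ![s]

def lAdd (s t : Term (lieSig k) X ()) : Term (lieSig k) X () :=
  .op (S := lieSig k) (.lin .add) ![s, t]
def lZero : Term (lieSig k) X () := .op (S := lieSig k) (.lin .zero) (fun j : Fin 0 => ![] j)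
def lSmul (c : k) (s : Term (lieSig k) X ()) : Term (lieSig k) X () :=
  .op (S := lieSig k) (.lin (.smul c)) ![s]
def lBracket (s t : Term (lieSig k) X ()) : Term (lieSig k) X () :=
  .op (S := lieSig k) .bracket ![s, t]

/-- A term in the linear operations as a term in the operations of Lie algebras. -/
def Term.toLie {i : Unit} : Term (vecSig k) X i → Term (lieSig k) X ()
  | .var x => .var x
  | .op o args => .op (S := lieSig k) (.lin o) (fun j => (args j).toLie)

end Linear

/-- A one-sorted identity in three variables. -/
def identity₃ {S : Signature.{u} Unit} (s t : Term S (fun _ => Fin 3) ()) : Identity S :=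
  ⟨fun _ => 3, (), s, t⟩

/-- The variable number `n` of a one-sorted identity in three variables. -/
def x₃ {S : Signature.{u} Unit} (n : Fin 3) : Term S (fun _ => Fin 3) () := .var n

variable (k : Type u) [Field k]

/-- The axioms of vector spaces over `k`. -/
inductive VecAxiom : Identity (vecSig k) → Prop
  | add_assoc : VecAxiom
      (identity₃ (vAdd (vAdd (x₃ 0) (x₃ 1)) (x₃ 2)) (vAdd (x₃ 0) (vAdd (x₃ 1) (x₃ 2))))
  | add_comm : VecAxiom (identity₃ (vAdd (x₃ 0) (x₃ 1)) (vAdd (x₃ 1) (x₃ 0)))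
  | add_zero : VecAxiom (identity₃ (vAdd (x₃ 0) vZero) (x₃ 0))
  | add_neg : VecAxiom (identity₃ (vAdd (x₃ 0) (vNeg (x₃ 0))) vZero)
  | smul_add (c : k) : VecAxiom
      (identity₃ (vSmul c (vAdd (x₃ 0) (x₃ 1))) (vAdd (vSmul c (x₃ 0)) (vSmul c (x₃ 1))))
  | add_smul (c d : k) : VecAxiom
      (identity₃ (vSmul (c + d) (x₃ 0)) (vAdd (vSmul c (x₃ 0)) (vSmul d (x₃ 0))))
  | mul_smul (c d : k) : VecAxiom (identity₃ (vSmul (c * d) (x₃ 0)) (vSmul c (vSmul d (x₃ 0))))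
  | one_smul : VecAxiom (identity₃ (vSmul 1 (x₃ 0)) (x₃ 0))

/-- The axioms of Lie algebras over `k`. -/
inductive LieAxiom : Identity (lieSig k) → Prop
  | lin (e : Identity (vecSig k)) (he : VecAxiom k e) :
      LieAxiom ⟨e.nvars, (), e.lhs.toLie, e.rhs.toLie⟩
  | add_bracket : LieAxiom (identity₃ (lBracket (lAdd (x₃ 0) (x₃ 1)) (x₃ 2))
      (lAdd (lBracket (x₃ 0) (x₃ 2)) (lBracket (x₃ 1) (x₃ 2))))
  | bracket_add : LieAxiom (identity₃ (lBracket (x₃ 0) (lAdd (x₃ 1) (x₃ 2)))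
      (lAdd (lBracket (x₃ 0) (x₃ 1)) (lBracket (x₃ 0) (x₃ 2))))
  | smul_bracket (c : k) : LieAxiom
      (identity₃ (lBracket (lSmul c (x₃ 0)) (x₃ 1)) (lSmul c (lBracket (x₃ 0) (x₃ 1))))
  | bracket_smul (c : k) : LieAxiom
      (identity₃ (lBracket (x₃ 0) (lSmul c (x₃ 1))) (lSmul c (lBracket (x₃ 0) (x₃ 1))))
  | bracket_self : LieAxiom (identity₃ (lBracket (x₃ 0) (x₃ 0)) lZero)
  | jacobi : LieAxiom (identity₃
      (lAdd (lAdd (lBracket (x₃ 0) (lBracket (x₃ 1) (x₃ 2)))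
        (lBracket (x₃ 1) (lBracket (x₃ 2) (x₃ 0)))) (lBracket (x₃ 2) (lBracket (x₃ 0) (x₃ 1))))
      lZero)

/-- The variety of all vector spaces over `k`. -/
def vectorSpaces : Set (Alg (vecSig k)) := Var {e | VecAxiom k e}

/-- The variety of all Lie algebras over `k`. -/
def lieAlgebras : Set (Alg (lieSig k)) := Var {e | LieAxiom k e}

/-! Representations of Lie algebras: the first sort is the Lie algebra, the second sort is the
vector space on which it acts. -/

abbrev repSig : Signature.{u} ActSort := actSig (lieSig k) (vecSig k)

/-- Two-sorted terms in two variables of the first sort and two variables of the second sort. -/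
abbrev RepTerm (i : ActSort) : Type u := Term (repSig k) (fun j => Fin (vars 2 2 j)) i

section RepTerms

variable {k}

/-- The `n`-th variable of the first sort. -/
def rx (n : Fin 2) : RepTerm k .one := .var (i := ActSort.one) n
/-- The `n`-th variable of the second sort. -/
def rv (n : Fin 2) : RepTerm k .two := .var (i := ActSort.two) n
def rAdd₁ (s t : RepTerm k .one) : RepTerm k .one :=
  .op (S := repSig k) (.first (.lin .add)) (fun j : Fin 2 => ![s, t] j)
def rSmul₁ (c : k) (s : RepTerm k .one) : RepTerm k .one :=
  .op (S := repSig k) (.first (.lin (.smul c))) (fun j : Fin 1 => ![s] j)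
def rBracket (s t : RepTerm k .one) : RepTerm k .one :=
  .op (S := repSig k) (.first .bracket) (fun j : Fin 2 => ![s, t] j)
def rZero₂ : RepTerm k .two := .op (S := repSig k) (.second .zero) (fun j : Fin 0 => ![] j)
def rNeg₂ (s : RepTerm k .two) : RepTerm k .two :=
  .op (S := repSig k) (.second .neg) (fun j : Fin 1 => ![s] j)
def rAdd₂ (s t : RepTerm k .two) : RepTerm k .two :=
  .op (S := repSig k) (.second .add) (fun j : Fin 2 => ![s, t] j)
def rSmul₂ (c : k) (s : RepTerm k .two) : RepTerm k .two :=
  .op (S := repSig k) (.second (.smul c)) (fun j : Fin 1 => ![s] j)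

end RepTerms

/-- An identity of the second sort in two variables of each sort. -/
def repIdentity (s t : RepTerm k .two) : Identity (repSig k) := ⟨vars 2 2, .two, s, t⟩

/-- The axioms of representations of Lie algebras over `k`. -/
inductive RepAxiom : Identity (repSig k) → Prop
  | lie (e : Identity (lieSig k)) (he : LieAxiom k e) : RepAxiom (e.toOne (vecSig k) 0)
  | vec (e : Identity (vecSig k)) (he : VecAxiom k e) : RepAxiom (e.toTwo (lieSig k) 0)
  | add_act : RepAxiom (repIdentity k ((rAdd₁ (rx 0) (rx 1)).act (rv 0))
      (rAdd₂ ((rx 0).act (rv 0)) ((rx 1).act (rv 0))))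
  | smul_act (c : k) : RepAxiom (repIdentity k ((rSmul₁ c (rx 0)).act (rv 0))
      (rSmul₂ c ((rx 0).act (rv 0))))
  | act_add : RepAxiom (repIdentity k ((rx 0).act (rAdd₂ (rv 0) (rv 1)))
      (rAdd₂ ((rx 0).act (rv 0)) ((rx 0).act (rv 1))))
  | act_smul (c : k) : RepAxiom (repIdentity k ((rx 0).act (rSmul₂ c (rv 0)))
      (rSmul₂ c ((rx 0).act (rv 0))))
  | bracket_act : RepAxiom (repIdentity k ((rBracket (rx 0) (rx 1)).act (rv 0))
      (rAdd₂ ((rx 0).act ((rx 1).act (rv 0))) (rNeg₂ ((rx 1).act ((rx 0).act (rv 0))))))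

/-- The variety of all representations of Lie algebras over `k`. -/
def lieReps : Set (Alg (repSig k)) := Var {e | RepAxiom k e}

/-- The subvariety of `Θ` defined by the identity `x ∘ v = 0`. -/
def nullAction {k : Type u} (Θ : Set (Alg (repSig k))) : Set (Alg (repSig k)) :=
  Θ ∩ Var {repIdentity k ((rx 0).act (rv 0)) rZero₂}

end ManySorted

/-! Everything rests on one test algebra per sort `s`: the representation `lineAlg k s`, a copy of
`k` in sort `s` and zero in the other sort, with zero bracket and zero action. It lies in `Θ`
(`lineAlg_mem`). By nondegeneracy some `A` in `Θ` has `a ≠ b` in sort `s`, and the line spanned by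
`a - b`, together with zero in the other sort, is a copy of `lineAlg k s` inside `A`: multiples of
one vector have zero bracket, and one argument of the action is always zero. Varieties are closed
under subalgebras. All operations of this algebra `K` are linear in the whole tuple of arguments, so
the homomorphisms from `F` to `K` form a vector space. If `F` is free on `Y`, restriction to
generators identifies it with the functions from `Y s` to `K s`, of dimension `|Y s|`. This
dimension is invariant under isomorphism, which gives every IBN claim (`IsLinearAlg.isIBNAt`).
Finally, linear functionals separate points, so an identity true in `k` holds in every vector space
(`satisfies_of_ofModule`); hence `Δ` has no identities of the second sort beyond those of vector
spaces. -/

namespace ManySorted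

/-! ### Homomorphisms, closure under subalgebras, nondegeneracy -/

section General

variable {Γ : Type} {S : Signature.{u} Γ}

theorem Hom.map_eval {A B : Alg S} (φ : Hom A B) {X : Γ → Type}
    (v : (i : Γ) → X i → A.carrier i) {i : Γ} (t : Term S X i) :
    φ.toFun i (t.eval A v) = t.eval B (fun j x => φ.toFun j (v j x)) := by
  induction t with
  | var x => rfl
  | op o args ih =>
    simp only [Term.eval, φ.map_op]
    exact congrArg _ (funext ih)

def Hom.comp {A B C : Alg S} (ψ : Hom B C) (φ : Hom A B) : Hom A C where
  toFun i a := ψ.toFun i (φ.toFun i a)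
  map_op o a := by rw [φ.map_op, ψ.map_op]

theorem Isomorphic.symm {A B : Alg S} (h : Isomorphic A B) : Isomorphic B A := by
  obtain ⟨φ, hφ⟩ := h
  let e := fun i => Equiv.ofBijective (φ.toFun i) (hφ i)
  refine ⟨⟨fun i => (e i).symm, fun o b => ?_⟩, fun i => (e i).symm.bijective⟩
  rw [Equiv.symm_apply_eq]
  refine Eq.trans ?_ (φ.map_op o _).symm
  exact congrArg _ (funext fun j => ((e _).apply_symm_apply (b j)).symm)

theorem Satisfies.of_injective [Finite Γ] {A B : Alg S} {e : Identity S} (φ : Hom A B)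
    (hφ : ∀ i, Function.Injective (φ.toFun i)) (h : Satisfies B e) : Satisfies A e := by
  intro v
  apply hφ
  rw [φ.map_eval, φ.map_eval]
  exact h _

theorem mem_of_injective [Finite Γ] {Θ : Set (Alg S)} (hΘ : IsVariety Θ) {A B : Alg S}
    (φ : Hom A B) (hφ : ∀ i, Function.Injective (φ.toFun i)) (hB : B ∈ Θ) : A ∈ Θ := by
  obtain ⟨I, rfl⟩ := hΘ
  exact fun e he => (hB e he).of_injective φ hφ

theorem nondegenerateAt_iff [Finite Γ] [DecidableEq Γ] {i : Γ} {Θ : Set (Alg S)} :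
    NondegenerateAt i Θ ↔ ∃ A ∈ Θ, ∃ a b : A.carrier i, a ≠ b := by
  constructor
  · intro h
    simp only [NondegenerateAt, identitiesOf, Satisfies, Set.mem_ofPred_eq, not_forall] at h
    obtain ⟨A, hA, v, hv⟩ := h
    exact ⟨A, hA, _, _, hv⟩
  · rintro ⟨A, hA, a, b, hab⟩ h
    -- There are no variables of sorts other than `i`, so an assignment exists even if `A` is empty
    -- in those sorts.
    have hlt : ∀ {j}, Fin (if j = i then 2 else 0) → j = i := by
      intro j n
      by_contra hj
      rw [if_neg hj] at n
      exact n.elim0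
    have := h A hA (fun j n => hlt n ▸ if n.val = 0 then a else b)
    exact hab (by simpa [collapse, Term.eval] using this)

end General

/-! ### Counting free generators by homomorphisms to a linear algebra -/

section Linear

variable {Γ : Type} {S : Signature.{u} Γ} (k : Type u) [Field k]

/-- The operations of `K` are linear with respect to given vector space structures on its
sorts. -/
structure IsLinearAlg (K : Alg S) [∀ i, AddCommGroup (K.carrier i)]
    [∀ i, Module k (K.carrier i)] : Prop where
  map_add : ∀ o a b, K.op o (a + b) = K.op o a + K.op o b
  map_smul : ∀ o (c : k) a, K.op o (c • a) = c • K.op o a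

variable {k} {K : Alg S} [∀ i, AddCommGroup (K.carrier i)] [∀ i, Module k (K.carrier i)]

/-- The vector space of all homomorphisms to an algebra with linear operations. -/
def homSpace (hK : IsLinearAlg k K) (F : Alg S) :
    Submodule k ((i : Γ) → F.carrier i → K.carrier i) where
  carrier := {g | ∀ o a, g _ (F.op o a) = K.op o (fun j => g _ (a j))}
  add_mem' {g h} hg hh o a := by
    refine Eq.trans ?_ (hK.map_add o _ _).symm
    exact congrArg₂ (· + ·) (hg o a) (hh o a)
  zero_mem' o a := by
    have := hK.map_smul o 0 0
    rw [zero_smul, zero_smul] at this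
    exact this.symm
  smul_mem' c g hg o a := by
    refine Eq.trans ?_ (hK.map_smul o c _).symm
    exact congrArg (c • ·) (hg o a)

/-- Restriction of homomorphisms to the generators of sort `i`. -/
def homRestrict (hK : IsLinearAlg k K) (F : Alg S) (i : Γ) (Y : Set (F.carrier i)) :
    homSpace hK F →ₗ[k] (Y → K.carrier i) where
  toFun g y := g.1 i y
  map_add' _ _ := rfl
  map_smul' _ _ := rfl

/-- This is the universal property of `F`: a homomorphism is an arbitrary choice of images of the
generators, and outside sort `i` there is only one choice. -/
theorem homRestrict_bijective [Finite Γ] (hK : IsLinearAlg k K) {Θ : Set (Alg S)} (hKΘ : K ∈ Θ)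
    {F : Alg S} {Y : (j : Γ) → Set (F.carrier j)} (hF : IsFree Θ F Y) (i : Γ)
    (hi : ∀ j, j ≠ i → Subsingleton (K.carrier j)) :
    Function.Bijective (homRestrict hK F i (Y i)) := by
  classical
  constructor
  · intro g h hgh
    have := (hF.2 K hKΘ (fun j y => g.1 j y)).unique (y₁ := ⟨g.1, g.2⟩) (y₂ := ⟨h.1, h.2⟩)
      (fun _ _ => rfl) (fun j y => by
        by_cases hj : j = i
        · subst hj
          exact (congrFun hgh y).symm
        · have := hi j hj
          exact Subsingleton.elim _ _)
    exact Subtype.ext (congrArg Hom.toFun this)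
  · intro f
    -- Generators of the other sorts are sent to zero.
    obtain ⟨φ, hφ, -⟩ := hF.2 K hKΘ (Pi.single (M := fun j => Y j → K.carrier j) i f)
    refine ⟨⟨φ.toFun, φ.map_op⟩, funext fun y => ?_⟩
    refine (hφ i y).trans ?_
    rw [Pi.single_eq_same]

theorem finrank_homSpace [Finite Γ] (hK : IsLinearAlg k K) {Θ : Set (Alg S)} (hKΘ : K ∈ Θ)
    {F : Alg S} {Y : (j : Γ) → Set (F.carrier j)} (hF : IsFree Θ F Y) (i : Γ)
    (hfin : (Y i).Finite) (hi : ∀ j, j ≠ i → Subsingleton (K.carrier j))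
    (hone : Module.finrank k (K.carrier i) = 1) :
    Module.finrank k (homSpace hK F) = (Y i).ncard := by
  have := hfin.fintype
  have : Module.Finite k (K.carrier i) := Module.finite_of_finrank_pos (by omega)
  rw [(LinearEquiv.ofBijective _ (homRestrict_bijective hK hKΘ hF i hi)).finrank_eq,
    Module.finrank_pi_fintype]
  simp only [hone, Finset.sum_const, Finset.card_univ, smul_eq_mul, mul_one]
  exact Set.fintypeCard_eq_ncard _

/-- Precomposition with a surjective homomorphism is linear and injective on homomorphisms to `K`.
Applied to an isomorphism and its inverse, this gives equality. -/
theorem finrank_homSpace_le (hK : IsLinearAlg k K) {F G : Alg S} (h : Isomorphic F G)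
    [FiniteDimensional k (homSpace hK F)] :
    Module.finrank k (homSpace hK G) ≤ Module.finrank k (homSpace hK F) := by
  obtain ⟨φ, hφ⟩ := h
  let T : homSpace hK G →ₗ[k] homSpace hK F :=
    { toFun g := ⟨_, ((⟨g.1, g.2⟩ : Hom G K).comp φ).map_op⟩
      map_add' _ _ := rfl
      map_smul' _ _ := rfl }
  refine LinearMap.finrank_le_finrank_of_injective (f := T) fun g h hgh => ?_
  refine Subtype.ext (funext fun i => funext fun b => ?_)
  obtain ⟨a, rfl⟩ := (hφ i).surjective b
  exact congrFun (congrFun (congrArg Subtype.val hgh) i) a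

/-- An algebra with linear operations which is one-dimensional in one sort and zero in all other
sorts makes the number of free generators of that sort an invariant. -/
theorem IsLinearAlg.isIBNAt [Finite Γ] (hK : IsLinearAlg k K) {Θ : Set (Alg S)} (hKΘ : K ∈ Θ)
    (i : Γ) (hi : ∀ j, j ≠ i → Subsingleton (K.carrier j))
    (hone : Module.finrank k (K.carrier i) = 1) : IsIBNAt i Θ := by
  intro F G Y Z hY hZ hF hG hFG
  have hfd : Module.Finite k (K.carrier i) := Module.finite_of_finrank_pos (by omega)
  have key : ∀ {F : Alg S} {Y : (j : Γ) → Set (F.carrier j)}, (Y i).Finite → IsFree Θ F Y →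
      FiniteDimensional k (homSpace hK F) := fun {F Y} hY hF => by
    have := hY.fintype
    exact (LinearEquiv.ofBijective _ (homRestrict_bijective hK hKΘ hF i hi)).symm.finiteDimensional
  have := key (hY i) hF
  have := key (hZ i) hG
  have h := le_antisymm (finrank_homSpace_le hK hFG.symm) (finrank_homSpace_le hK hFG)
  rw [finrank_homSpace hK hKΘ hF i (hY i) hi hone,
    finrank_homSpace hK hKΘ hG i (hZ i) hi hone] at h
  rw [← (hY i).cast_ncard_eq, ← (hZ i).cast_ncard_eq, h]

end Linear

/-! ### The one-sorted parts of an algebra with an action -/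

section Parts

variable {S₁ S₂ : Signature.{u} Unit}

/-- The first sort of an algebra with an action. -/
@[reducible]
def Alg.one (A : Alg (actSig S₁ S₂)) : Alg S₁ where
  carrier _ := A.carrier .one
  op o a := A.op (.first o) a

/-- The second sort of an algebra with an action. -/
@[reducible]
def Alg.two (A : Alg (actSig S₁ S₂)) : Alg S₂ where
  carrier _ := A.carrier .two
  op o a := A.op (.second o) a

theorem Term.eval_toOne (A : Alg (actSig S₁ S₂)) {X : ActSort → Type}
    (v : (i : ActSort) → X i → A.carrier i) {i : Unit} (t : Term S₁ (fun _ => X .one) i) :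
    (Term.toOne (S₂ := S₂) t).eval A v = t.eval A.one (fun _ => v .one) := by
  induction t with
  | var x => rfl
  | op o args ih => exact congrArg (A.op (.first o)) (funext ih)

theorem Term.eval_toTwo (A : Alg (actSig S₁ S₂)) {X : ActSort → Type}
    (v : (i : ActSort) → X i → A.carrier i) {i : Unit} (t : Term S₂ (fun _ => X .two) i) :
    (Term.toTwo (S₁ := S₁) t).eval A v = t.eval A.two (fun _ => v .two) := by
  induction t with
  | var x => rfl
  | op o args ih => exact congrArg (A.op (.second o)) (funext ih)

/-- The element `b` supplies values for the `m` extra variables; were the second sort empty, the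
hypothesis could hold vacuously. -/
theorem satisfies_one {A : Alg (actSig S₁ S₂)} (b : A.carrier .two) {e : Identity S₁} {m : ℕ}
    (h : Satisfies A (e.toOne S₂ m)) : Satisfies A.one e := by
  intro v
  let w : (i : ActSort) → Fin (vars (e.nvars ()) m i) → A.carrier i := fun i => match i with
    | .one => v ()
    | .two => fun _ => b
  exact (Term.eval_toOne A w e.lhs).symm.trans ((h w).trans (Term.eval_toOne A w e.rhs))

theorem satisfies_two {A : Alg (actSig S₁ S₂)} (a : A.carrier .one) {e : Identity S₂} {m : ℕ}
    (h : Satisfies A (e.toTwo S₁ m)) : Satisfies A.two e := by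
  intro v
  let w : (i : ActSort) → Fin (vars m (e.nvars ()) i) → A.carrier i := fun i => match i with
    | .one => fun _ => a
    | .two => v ()
  exact (Term.eval_toTwo A w e.lhs).symm.trans ((h w).trans (Term.eval_toTwo A w e.rhs))

theorem one_mem_partOne {Θ : Set (Alg (actSig S₁ S₂))} {A : Alg (actSig S₁ S₂)} (hA : A ∈ Θ)
    (b : A.carrier .two) : A.one ∈ partOne Θ :=
  fun _ ⟨_, hm⟩ => satisfies_one b (hm A hA)

theorem two_mem_partTwo {Θ : Set (Alg (actSig S₁ S₂))} {A : Alg (actSig S₁ S₂)} (hA : A ∈ Θ)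
    (a : A.carrier .one) : A.two ∈ partTwo Θ :=
  fun _ ⟨_, hm⟩ => satisfies_two a (hm A hA)

end Parts

/-! ### Algebras of the variety of vector spaces as modules -/

section VectorSpaces

variable {k : Type u}

/-- The structure of an algebra of the signature of vector spaces on a vector space. -/
@[reducible]
def ofModule (k M : Type u) [Field k] [AddCommGroup M] [Module k M] : Alg (vecSig k) where
  carrier _ := M
  op o := match o with
    | .zero => fun _ => 0
    | .neg => fun a : Fin 1 → M => -a 0
    | .add => fun a : Fin 2 → M => a 0 + a 1
    | .smul c => fun a : Fin 1 → M => c • a 0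

theorem eval_vAdd (V : Alg (vecSig k)) {X : Unit → Type} (v : (i : Unit) → X i → V.carrier i)
    (s t : Term (vecSig k) X ()) :
    (vAdd s t).eval V v = V.op .add (fun j : Fin 2 => ![s.eval V v, t.eval V v] j) :=
  congrArg (V.op .add) (funext fun j : Fin 2 => by fin_cases j <;> rfl)

theorem eval_vZero (V : Alg (vecSig k)) {X : Unit → Type} (v : (i : Unit) → X i → V.carrier i) :
    vZero.eval V v = V.op .zero (fun j : Fin 0 => j.elim0) :=
  congrArg (V.op .zero) (funext fun j : Fin 0 => j.elim0)

theorem eval_vNeg (V : Alg (vecSig k)) {X : Unit → Type} (v : (i : Unit) → X i → V.carrier i)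
    (s : Term (vecSig k) X ()) :
    (vNeg s).eval V v = V.op .neg (fun _ : Fin 1 => s.eval V v) :=
  congrArg (V.op .neg) (funext fun j : Fin 1 => by fin_cases j; rfl)

theorem eval_vSmul (V : Alg (vecSig k)) {X : Unit → Type} (v : (i : Unit) → X i → V.carrier i)
    (c : k) (s : Term (vecSig k) X ()) :
    (vSmul c s).eval V v = V.op (.smul c) (fun _ : Fin 1 => s.eval V v) :=
  congrArg (V.op (.smul c)) (funext fun j : Fin 1 => by fin_cases j; rfl)

variable [Field k] {V : Alg (vecSig k)}

theorem eval_eq_of_vecAxiom (hV : V ∈ vectorSpaces k) {s t : Term (vecSig k) (fun _ => Fin 3) ()}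
    (h : VecAxiom k (identity₃ s t)) (a b c : V.carrier ()) :
    s.eval V (fun _ => ![a, b, c]) = t.eval V (fun _ => ![a, b, c]) :=
  hV _ h _

/-- The structure of an abelian group on a vector space viewed as an algebra. -/
@[reducible]
def addCommGroupOf (hV : V ∈ vectorSpaces k) : AddCommGroup (V.carrier ()) :=
  letI : Zero (V.carrier ()) := ⟨V.op .zero (fun j : Fin 0 => j.elim0)⟩
  letI : Neg (V.carrier ()) := ⟨fun a => V.op .neg (fun _ : Fin 1 => a)⟩
  letI : Add (V.carrier ()) := ⟨fun a b => V.op .add (fun j : Fin 2 => ![a, b] j)⟩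
  have comm : ∀ a b : V.carrier (), a + b = b + a := fun a b => by
      have h := eval_eq_of_vecAxiom hV .add_comm a b a
      simp only [eval_vAdd] at h
      exact h
  have zero : ∀ a : V.carrier (), a + 0 = a := fun a => by
      have h := eval_eq_of_vecAxiom hV .add_zero a a a
      simp only [eval_vAdd, eval_vZero] at h
      exact h
  { add_assoc a b c := by
      have h := eval_eq_of_vecAxiom hV .add_assoc a b c
      simp only [eval_vAdd] at h
      exact h
    zero_add a := (comm 0 a).trans (zero a)
    add_zero := zero
    nsmul := nsmulRec
    zsmul := zsmulRec
    neg_add_cancel a := (comm _ a).trans <| by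
      have h := eval_eq_of_vecAxiom hV .add_neg a a a
      simp only [eval_vAdd, eval_vNeg, eval_vZero] at h
      exact h
    add_comm := comm }

/-- The structure of a vector space on a vector space viewed as an algebra. -/
@[reducible]
def moduleOf (hV : V ∈ vectorSpaces k) :
    letI := addCommGroupOf hV
    Module k (V.carrier ()) :=
  letI := addCommGroupOf hV
  letI : SMul k (V.carrier ()) := ⟨fun c a => V.op (.smul c) (fun _ : Fin 1 => a)⟩
  Module.ofMinimalAxioms
    (fun c a b => by
      have h := eval_eq_of_vecAxiom hV (.smul_add c) a b a
      simp only [eval_vAdd, eval_vSmul] at h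
      exact h)
    (fun c d a => by
      have h := eval_eq_of_vecAxiom hV (.add_smul c d) a a a
      simp only [eval_vAdd, eval_vSmul] at h
      exact h)
    (fun c d a => by
      have h := eval_eq_of_vecAxiom hV (.mul_smul c d) a a a
      simp only [eval_vSmul] at h
      exact h)
    (fun a => by
      have h := eval_eq_of_vecAxiom hV .one_smul a a a
      simp only [eval_vSmul] at h
      exact h)

/-- The operations of a vector space viewed as an algebra are those of its module structure. -/
theorem op_eq_ofModule (hV : V ∈ vectorSpaces k) (o : VecOp k)
    (a : Fin o.arity → V.carrier ()) :
    letI := addCommGroupOf hV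
    letI := moduleOf hV
    V.op o a = (ofModule k (V.carrier ())).op o a := by
  cases o with
  | zero => exact congrArg (V.op .zero) (funext fun j : Fin 0 => j.elim0)
  | neg =>
    exact congrArg (V.op .neg)
      (funext fun j : Fin 1 => congrArg (β := V.carrier ()) a (Subsingleton.elim j 0))
  | add =>
    have key : ∀ j : Fin 2, (a : Fin 2 → V.carrier ()) j
        = ![a (0 : Fin 2), a (1 : Fin 2)] j :=
      Fin.forall_fin_two.2 ⟨rfl, rfl⟩
    exact congrArg (V.op .add) (funext key)
  | smul c =>
    exact congrArg (V.op (.smul c))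
      (funext fun j : Fin 1 => congrArg (β := V.carrier ()) a (Subsingleton.elim j 0))

theorem map_op_ofModule {M N : Type u} [AddCommGroup M] [Module k M] [AddCommGroup N]
    [Module k N] (f : M →ₗ[k] N) (o : VecOp k) (a : Fin o.arity → M) :
    f ((ofModule k M).op o a) = (ofModule k N).op o (fun j => f (a j)) := by
  cases o with
  | zero => exact f.map_zero
  | neg => exact f.map_neg _
  | add => exact f.map_add _ _
  | smul c => exact f.map_smul c _

/-- Over a field, a nonzero vector is detected by some linear functional. -/
theorem eq_of_forall_dual {M : Type u} [AddCommGroup M] [Module k M] {a b : M}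
    (h : ∀ f : Module.Dual k M, f a = f b) : a = b := by
  rw [← sub_eq_zero, ← Module.forall_dual_apply_eq_zero_iff k]
  intro f
  rw [map_sub, h, sub_self]

/-- Every identity of the one-dimensional vector space holds in all vector spaces. -/
theorem satisfies_of_ofModule (hV : V ∈ vectorSpaces k) {e : Identity (vecSig k)}
    (h : Satisfies (ofModule k k) e) : Satisfies V e := by
  let := addCommGroupOf hV
  let := moduleOf hV
  intro v
  refine eq_of_forall_dual (k := k) fun f => ?_
  -- Each functional is a homomorphism to `k`, where the two sides of the identity agree.
  let φ : Hom V (ofModule k k) :=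
    ⟨fun _ => f, fun o a => (congrArg f (op_eq_ofModule hV o a)).trans (map_op_ofModule f o a)⟩
  exact (φ.map_eval v e.lhs).trans ((h _).trans (φ.map_eval v e.rhs).symm)

end VectorSpaces

/-! ### Lie algebras: every line is an abelian subalgebra -/

section LieAlgebras

variable {k : Type u}

/-- The underlying vector space of a Lie algebra. -/
@[reducible]
def Alg.lin (L : Alg (lieSig k)) : Alg (vecSig k) where
  carrier _ := L.carrier ()
  op o a := L.op (.lin o) a

theorem Term.eval_toLie (L : Alg (lieSig k)) {X : Unit → Type}
    (v : (i : Unit) → X i → L.carrier i) {i : Unit} (t : Term (vecSig k) X i) :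
    t.toLie.eval L v = t.eval L.lin v := by
  induction t with
  | var x => rfl
  | op o args ih => exact congrArg (L.op (.lin o)) (funext ih)

theorem eval_lBracket (L : Alg (lieSig k)) {X : Unit → Type}
    (v : (i : Unit) → X i → L.carrier i) (s t : Term (lieSig k) X ()) :
    (lBracket s t).eval L v = L.op .bracket (fun j : Fin 2 => ![s.eval L v, t.eval L v] j) :=
  congrArg (L.op .bracket) (funext fun j : Fin 2 => by fin_cases j <;> rfl)

theorem eval_lSmul (L : Alg (lieSig k)) {X : Unit → Type} (v : (i : Unit) → X i → L.carrier i)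
    (c : k) (s : Term (lieSig k) X ()) :
    (lSmul c s).eval L v = L.op (.lin (.smul c)) (fun _ : Fin 1 => s.eval L v) :=
  congrArg (L.op (.lin (.smul c))) (funext fun j : Fin 1 => by fin_cases j; rfl)

theorem eval_lZero (L : Alg (lieSig k)) {X : Unit → Type}
    (v : (i : Unit) → X i → L.carrier i) :
    lZero.eval L v = L.op (.lin .zero) (fun j : Fin 0 => j.elim0) :=
  congrArg (L.op (.lin .zero)) (funext fun j : Fin 0 => j.elim0)

variable [Field k] {L : Alg (lieSig k)}

theorem lin_mem_vectorSpaces (hL : L ∈ lieAlgebras k) : L.lin ∈ vectorSpaces k := by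
  intro e he v
  exact (Term.eval_toLie L v e.lhs).symm.trans
    ((hL _ (LieAxiom.lin e he) v).trans (Term.eval_toLie L v e.rhs))

theorem eval_eq_of_lieAxiom (hL : L ∈ lieAlgebras k) {s t : Term (lieSig k) (fun _ => Fin 3) ()}
    (h : LieAxiom k (identity₃ s t)) (a b c : L.carrier ()) :
    s.eval L (fun _ => ![a, b, c]) = t.eval L (fun _ => ![a, b, c]) :=
  hL _ h _

theorem bracket_smul_smul (hL : L ∈ lieAlgebras k) (c d : k) (x : L.carrier ()) :
    letI := addCommGroupOf (lin_mem_vectorSpaces hL)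
    letI := moduleOf (lin_mem_vectorSpaces hL)
    L.op .bracket (fun j : Fin 2 => ![c • x, d • x] j) = (0 : L.carrier ()) := by
  let := addCommGroupOf (lin_mem_vectorSpaces hL)
  let := moduleOf (lin_mem_vectorSpaces hL)
  have h₁ : ∀ (c : k) (x y : L.carrier ()), L.op .bracket (fun j : Fin 2 => ![c • x, y] j)
      = (c • L.op .bracket (fun j : Fin 2 => ![x, y] j) : L.carrier ()) := fun c x y => by
    have h := eval_eq_of_lieAxiom hL (.smul_bracket c) x y x
    simp only [eval_lBracket, eval_lSmul] at h
    exact h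
  have h₂ : ∀ (c : k) (x y : L.carrier ()), L.op .bracket (fun j : Fin 2 => ![x, c • y] j)
      = (c • L.op .bracket (fun j : Fin 2 => ![x, y] j) : L.carrier ()) := fun c x y => by
    have h := eval_eq_of_lieAxiom hL (.bracket_smul c) x y x
    simp only [eval_lBracket, eval_lSmul] at h
    exact h
  have h₃ : L.op .bracket (fun j : Fin 2 => ![x, x] j) = (0 : L.carrier ()) := by
    have h := eval_eq_of_lieAxiom hL .bracket_self x x x
    simp only [eval_lBracket, eval_lZero] at h
    exact h
  refine (h₁ c x _).trans ?_
  refine (congrArg (c • ·) ((h₂ d x x).trans (congrArg (d • ·) h₃))).trans ?_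
  simp only [smul_zero]

end LieAlgebras

/-! ### Representations: bilinearity of the action in scalars -/

section Representations

variable {k : Type u}

/-- The action of the first sort on the second one. -/
def Alg.act (A : Alg (repSig k)) (x : A.carrier .one) (y : A.carrier .two) : A.carrier .two :=
  A.op .act (fun j : Fin 2 => match j with
    | 0 => x
    | 1 => y)

theorem op_act (A : Alg (repSig k))
    (a : (j : Fin 2) → A.carrier ((repSig k).dom .act j)) :
    A.op .act a = A.act (a 0) (a 1) :=
  congrArg (A.op .act) (funext (Fin.forall_fin_two.2 ⟨rfl, rfl⟩))

theorem eval_act (A : Alg (repSig k)) {X : ActSort → Type}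
    (v : (i : ActSort) → X i → A.carrier i) (s : Term (repSig k) X .one)
    (t : Term (repSig k) X .two) :
    (s.act t).eval A v = A.act (s.eval A v) (t.eval A v) :=
  op_act A _

theorem eval_rSmul₁ (A : Alg (repSig k))
    (v : (i : ActSort) → Fin (vars 2 2 i) → A.carrier i) (c : k) (s : RepTerm k .one) :
    (rSmul₁ c s).eval A v = A.op (.first (.lin (.smul c))) (fun _ : Fin 1 => s.eval A v) :=
  congrArg (A.op (.first (.lin (.smul c)))) (funext fun j : Fin 1 => by fin_cases j; rfl)

theorem eval_rSmul₂ (A : Alg (repSig k))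
    (v : (i : ActSort) → Fin (vars 2 2 i) → A.carrier i) (c : k) (s : RepTerm k .two) :
    (rSmul₂ c s).eval A v = A.op (.second (.smul c)) (fun _ : Fin 1 => s.eval A v) :=
  congrArg (A.op (.second (.smul c))) (funext fun j : Fin 1 => by fin_cases j; rfl)

theorem eval_rZero₂ (A : Alg (repSig k))
    (v : (i : ActSort) → Fin (vars 2 2 i) → A.carrier i) :
    rZero₂.eval A v = A.op (.second .zero) (fun j : Fin 0 => j.elim0) :=
  congrArg (A.op (.second .zero)) (funext fun j : Fin 0 => j.elim0)

variable [Field k] {A : Alg (repSig k)}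

theorem one_mem_lieAlgebras (hA : A ∈ lieReps k) : A.one ∈ lieAlgebras k :=
  fun e he => satisfies_one (A.op (.second .zero) (fun j : Fin 0 => j.elim0))
    (hA _ (RepAxiom.lie e he))

theorem two_mem_vectorSpaces (hA : A ∈ lieReps k) : A.two ∈ vectorSpaces k :=
  fun e he => satisfies_two (A.op (.first (.lin .zero)) (fun j : Fin 0 => j.elim0))
    (hA _ (RepAxiom.vec e he))

theorem lin_one_mem_vectorSpaces (hA : A ∈ lieReps k) : A.one.lin ∈ vectorSpaces k :=
  lin_mem_vectorSpaces (one_mem_lieAlgebras hA)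

theorem eval_eq_of_repAxiom (hA : A ∈ lieReps k) {s t : RepTerm k .two}
    (h : RepAxiom k (repIdentity k s t)) (v : (i : ActSort) → Fin (vars 2 2 i) → A.carrier i) :
    s.eval A v = t.eval A v :=
  hA _ h v

theorem act_smul_smul (hA : A ∈ lieReps k) (c d : k) (x : A.carrier .one) (y : A.carrier .two) :
    letI : AddCommGroup (A.carrier .one) := addCommGroupOf (lin_one_mem_vectorSpaces hA)
    letI : Module k (A.carrier .one) := moduleOf (lin_one_mem_vectorSpaces hA)
    letI : AddCommGroup (A.carrier .two) := addCommGroupOf (two_mem_vectorSpaces hA)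
    letI : Module k (A.carrier .two) := moduleOf (two_mem_vectorSpaces hA)
    A.act (c • x) (d • y) = c • d • A.act x y := by
  let : AddCommGroup (A.carrier .one) := addCommGroupOf (lin_one_mem_vectorSpaces hA)
  let : Module k (A.carrier .one) := moduleOf (lin_one_mem_vectorSpaces hA)
  let : AddCommGroup (A.carrier .two) := addCommGroupOf (two_mem_vectorSpaces hA)
  let : Module k (A.carrier .two) := moduleOf (two_mem_vectorSpaces hA)
  have h₁ : ∀ (c : k) (x : A.carrier .one) (y : A.carrier .two),
      A.act (c • x) y = c • A.act x y := fun c x y => by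
    let v : (i : ActSort) → Fin (vars 2 2 i) → A.carrier i := fun i => match i with
      | .one => fun _ => x
      | .two => fun _ => y
    have h := eval_eq_of_repAxiom hA (.smul_act c) v
    rw [eval_act, eval_rSmul₁, eval_rSmul₂, eval_act] at h
    exact h
  have h₂ : ∀ (c : k) (x : A.carrier .one) (y : A.carrier .two),
      A.act x (c • y) = c • A.act x y := fun c x y => by
    let v : (i : ActSort) → Fin (vars 2 2 i) → A.carrier i := fun i => match i with
      | .one => fun _ => x
      | .two => fun _ => y
    have h := eval_eq_of_repAxiom hA (.act_smul c) v
    rw [eval_act, eval_rSmul₂, eval_rSmul₂, eval_act] at h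
    exact h
  rw [h₁, h₂]

end Representations

/-! ### The one-dimensional test representations -/

section Line

variable (k : Type u) [Field k]

/-- The one-dimensional vector space in the sort `s` and zero in the other sort. -/
def line (s i : ActSort) : Submodule k k := if i = s then ⊤ else ⊥

theorem line_self (s : ActSort) : line k s s = ⊤ := if_pos rfl

theorem finrank_line (s : ActSort) : Module.finrank k (line k s s) = 1 := by
  rw [line_self, finrank_top, Module.finrank_self]

variable {k} in
theorem eq_zero_of_line {s i : ActSort} (h : i ≠ s) (c : line k s i) : c = 0 :=
  Subtype.ext ((Submodule.mem_bot k).1 ((if_neg h : line k s i = ⊥).le c.2))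

theorem subsingleton_line {s i : ActSort} (h : i ≠ s) : Subsingleton (line k s i) :=
  ⟨fun c d => (eq_zero_of_line h c).trans (eq_zero_of_line h d).symm⟩

theorem exists_ne_line (s : ActSort) : ∃ c d : line k s s, c ≠ d := by
  have : 0 < Module.finrank k (line k s s) := by rw [finrank_line]; exact one_pos
  have := Module.nontrivial_of_finrank_pos this
  exact exists_pair_ne _

/-- The representation with zero bracket and zero action which is one-dimensional in the sort `s`
and zero in the other sort. -/
@[reducible]
def lineAlg (s : ActSort) : Alg (repSig k) where
  carrier i := line k s i
  op o := match o with
    | .first (.lin o) => (ofModule k (line k s .one)).op o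
    | .first .bracket => fun _ => 0
    | .second o => (ofModule k (line k s .two)).op o
    | .act => fun _ => 0

theorem isLinearAlg_ofModule (M : Type u) [AddCommGroup M] [Module k M] :
    IsLinearAlg k (ofModule k M) where
  map_add o a b := by
    cases o with
    | zero => exact (add_zero _).symm
    | neg => exact neg_add _ _
    | add => exact add_add_add_comm _ _ _ _
    | smul c => exact smul_add _ _ _
  map_smul o c a := by
    cases o with
    | zero => exact (smul_zero _).symm
    | neg => exact (smul_neg _ _).symm
    | add => exact (smul_add _ _ _).symm
    | smul d => exact smul_comm _ _ _

/-- Bilinear operations are in general not additive in the pair of arguments; bracket and action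
qualify here because they vanish. -/
theorem isLinearAlg_lineAlg (s : ActSort) : IsLinearAlg k (lineAlg k s) where
  map_add o a b := match o with
    | .first (.lin o) => (isLinearAlg_ofModule k (line k s .one)).map_add o a b
    | .first .bracket => (add_zero _).symm
    | .second o => (isLinearAlg_ofModule k (line k s .two)).map_add o a b
    | .act => (add_zero _).symm
  map_smul o c a := match o with
    | .first (.lin o) => (isLinearAlg_ofModule k (line k s .one)).map_smul o c a
    | .first .bracket => (smul_zero _).symm
    | .second o => (isLinearAlg_ofModule k (line k s .two)).map_smul o c a
    | .act => (smul_zero _).symm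

theorem isLinearAlg_lineAlg_one : IsLinearAlg k (lineAlg k .one).one where
  map_add o a b := (isLinearAlg_lineAlg k .one).map_add (.first o) a b
  map_smul o c a := (isLinearAlg_lineAlg k .one).map_smul (.first o) c a

variable {k} {A : Alg (repSig k)}

/-- The homomorphism which maps the basis vector of `lineAlg k s` to one of `x`, `y`. -/
def lineHom (hA : A ∈ lieReps k) (s : ActSort) (x : A.carrier .one) (y : A.carrier .two) :
    Hom (lineAlg k s) A :=
  letI : AddCommGroup (A.carrier .one) := addCommGroupOf (lin_one_mem_vectorSpaces hA)
  letI : Module k (A.carrier .one) := moduleOf (lin_one_mem_vectorSpaces hA)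
  letI : AddCommGroup (A.carrier .two) := addCommGroupOf (two_mem_vectorSpaces hA)
  letI : Module k (A.carrier .two) := moduleOf (two_mem_vectorSpaces hA)
  let f : line k s .one →ₗ[k] A.carrier .one :=
    (LinearMap.toSpanSingleton k _ x).comp (line k s .one).subtype
  let g : line k s .two →ₗ[k] A.carrier .two :=
    (LinearMap.toSpanSingleton k _ y).comp (line k s .two).subtype
  { toFun i := match i with
      | .one => f
      | .two => g
    map_op o a := match o with
      | .first (.lin o) => (map_op_ofModule f o a).trans
          (op_eq_ofModule (lin_one_mem_vectorSpaces hA) o _).symm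
      | .second o => (map_op_ofModule g o a).trans
          (op_eq_ofModule (two_mem_vectorSpaces hA) o _).symm
      | .first .bracket => by
        refine f.map_zero.trans ?_
        -- Both arguments are sent to multiples of the same `x`, so their bracket is zero.
        refine (bracket_smul_smul (one_mem_lieAlgebras hA) (a (0 : Fin 2)).1
          (a (1 : Fin 2)).1 x).symm.trans ?_
        exact congrArg (A.op (.first .bracket)) (funext (Fin.forall_fin_two.2 ⟨rfl, rfl⟩))
      | .act => by
        refine g.map_zero.trans (Eq.trans ?_ (op_act A _).symm)
        let c : line k s .one := a (0 : Fin 2)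
        let d : line k s .two := a (1 : Fin 2)
        refine Eq.trans ?_ (act_smul_smul hA c.1 d.1 x y).symm
        -- Only sort `s` is nonzero, so one of the scalars `c`, `d` vanishes.
        by_cases hs : ActSort.one = s
        · have hd : d = 0 := eq_zero_of_line (by rw [← hs]; decide) d
          rw [hd, Submodule.coe_zero, zero_smul, smul_zero]
        · rw [eq_zero_of_line hs c, Submodule.coe_zero, zero_smul] }

theorem lineAlg_mem {Θ : Set (Alg (repSig k))} (hvar : IsVariety Θ) (hrep : Θ ⊆ lieReps k)
    {s : ActSort} (hnd : NondegenerateAt s Θ) : lineAlg k s ∈ Θ := by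
  obtain ⟨A, hA, a, b, hab⟩ := nondegenerateAt_iff.1 hnd
  have hA' := hrep hA
  let : AddCommGroup (A.carrier .one) := addCommGroupOf (lin_one_mem_vectorSpaces hA')
  let : Module k (A.carrier .one) := moduleOf (lin_one_mem_vectorSpaces hA')
  let : AddCommGroup (A.carrier .two) := addCommGroupOf (two_mem_vectorSpaces hA')
  let : Module k (A.carrier .two) := moduleOf (two_mem_vectorSpaces hA')
  have key : ∃ (x : A.carrier .one) (y : A.carrier .two),
      Function.Injective ((lineHom hA' s x y).toFun s) := by
    cases s with
    | one =>
      -- Scaling the nonzero vector `a - b` is injective; the vector chosen in the other sort plays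
      -- no role.
      exact ⟨a - b, 0, fun c d h => Subtype.ext (smul_left_injective k (sub_ne_zero.2 hab) h)⟩
    | two =>
      exact ⟨0, a - b, fun c d h => Subtype.ext (smul_left_injective k (sub_ne_zero.2 hab) h)⟩
  obtain ⟨x, y, h⟩ := key
  refine mem_of_injective hvar (lineHom hA' s x y) (fun i => ?_) hA
  by_cases hi : i = s
  · rw [hi]; exact h
  · have := subsingleton_line k hi
    exact fun c d _ => Subsingleton.elim (α := line k s i) c d

theorem lineAlg_mem_nullAction {Θ : Set (Alg (repSig k))} {s : ActSort} (h : lineAlg k s ∈ Θ) :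
    lineAlg k s ∈ nullAction Θ := by
  refine ⟨h, ?_⟩
  rintro e rfl v
  exact (eval_act _ v (rx 0) (rv 0)).trans (eval_rZero₂ _ v).symm

theorem partTwo_nullAction {Θ : Set (Alg (repSig k))} (hrep : Θ ⊆ lieReps k)
    (h : lineAlg k .two ∈ Θ) : partTwo (nullAction Θ) = vectorSpaces k := by
  refine Set.Subset.antisymm (fun V hV e he => hV e ⟨0, fun A hA => ?_⟩) ?_
  · exact hrep hA.1 _ (RepAxiom.vec e he)
  · rintro V hV e ⟨m, hm⟩
    have h₁ : Satisfies (lineAlg k .two).two e :=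
      satisfies_two (0 : line k .two .one) (hm _ (lineAlg_mem_nullAction h))
    -- The line is all of `k`, so `k` embeds in it and inherits its identities.
    let f : k →ₗ[k] line k .two .two :=
      LinearMap.codRestrict _ LinearMap.id (fun c => by rw [line_self]; trivial)
    let φ : Hom (ofModule k k) (lineAlg k .two).two := ⟨fun _ => f, map_op_ofModule f⟩
    exact satisfies_of_ofModule hV
      (h₁.of_injective φ fun _ c d hcd => congrArg Subtype.val hcd)

end Line

end ManySorted

theorem mainTheorem3 {k : Type*} [Field k] (Θ : Set (ManySorted.Alg (ManySorted.repSig k)))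
    (hvar : ManySorted.IsVariety Θ) (hrep : Θ ⊆ ManySorted.lieReps k)
    (hnd : ManySorted.Nondegenerate Θ) :
    (ManySorted.partOne Θ ⊆ ManySorted.lieAlgebras k ∧
      ManySorted.Nondegenerate (ManySorted.partOne Θ) ∧
      ManySorted.IsIBN (ManySorted.partOne Θ)) ∧
    (ManySorted.partTwo (ManySorted.nullAction Θ) = ManySorted.vectorSpaces k ∧
      ManySorted.IsIBN (ManySorted.partTwo (ManySorted.nullAction Θ)) ∧
      ManySorted.NondegenerateAt .two (ManySorted.nullAction Θ) ∧
      ManySorted.IsIBNAt .two (ManySorted.nullAction Θ)) ∧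
    ManySorted.IsIBN Θ := by
  open ManySorted in
  have hline : ∀ s, lineAlg k s ∈ Θ := fun s => lineAlg_mem hvar hrep (hnd s)
  have hone : (lineAlg k .one).one ∈ partOne Θ :=
    one_mem_partOne (hline .one) (0 : line k .one .two)
  have htwo : (lineAlg k .two).two ∈ partTwo (nullAction Θ) :=
    two_mem_partTwo (lineAlg_mem_nullAction (hline .two)) (0 : line k .two .one)
  have hnull := lineAlg_mem_nullAction (hline .two)
  have hsub : ∀ s i : ActSort, i ≠ s → Subsingleton ((lineAlg k s).carrier i) :=
    fun s i hi => subsingleton_line k hi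
  refine ⟨⟨fun L hL e he => hL e ⟨0, fun A hA => hrep hA _ (RepAxiom.lie e he)⟩, fun i => ?_,
      fun i => ?_⟩, ⟨partTwo_nullAction hrep (hline .two), fun i => ?_, ?_, ?_⟩, fun i => ?_⟩
  · exact nondegenerateAt_iff.2 ⟨_, hone, exists_ne_line k .one⟩
  · exact (isLinearAlg_lineAlg_one k).isIBNAt hone i (fun j hj => (hj rfl).elim)
      (finrank_line k .one)
  -- The second part of `lineAlg k .two` is by definition `ofModule` of the line.
  · exact (isLinearAlg_ofModule k (line k .two .two)).isIBNAt htwo i (fun j hj => (hj rfl).elim)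
      (finrank_line k .two)
  · exact nondegenerateAt_iff.2 ⟨_, hnull, exists_ne_line k .two⟩
  · exact (isLinearAlg_lineAlg k .two).isIBNAt hnull .two (hsub .two) (finrank_line k .two)
  · exact (isLinearAlg_lineAlg k i).isIBNAt (hline i) i (hsub i) (finrank_line k i)
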